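/- Let $\mathcal F=\mathbb C\Omega\oplus\bigoplus_{n\ge1}L^2(\mathbb R_+)^{\otimes n}$ (complex $L^2$) be the full Fock space. For real $h\in L^2_{\mathbb R}(\mathbb R_+)$ let $l(h)$ be the left creation operator, $l(h)(g_1\otimes\cdots\otimes g_n)=h\otimes g_1\otimes\cdots\otimes g_n$, and let $S(h)=l(h)+l(h)^*$. Let $\mathcal{SC}_{alg}$ be the unital $*$-algebra generated by the operators $S(h)$, $\mathcal{SC}$ the von Neumann algebra it generates, and $\tau(X)=\langle X\Omega,\Omega\rangle$. The space $L^2(\mathcal{SC},\tau)$ is realized in $\mathcal F$ through $X\mapsto X\Omega$, and $L^2(\mathcal{SC}^{\otimes m},\tau^{\otimes m})$ in $\mathcal F^{\otimes m}$ through $X_1\otimes\cdots\otimes X_m\mapsto X_1\Omega\otimes\cdots\otimes X_m\Omega$. The free Malliavin derivative $\nabla=(\nabla_t)_{t\ge0}$ is the derivation on $\mathcal{SC}_{alg}$ with $\nabla_tS(h)=h(t)\,1\otimes1$, where the left and right actions are multiplication on the left and right leg of the tensor product. For $n\ge1$, $$\nabla^n_{t_1,\dots,t_n}=(\mathrm{id}^{\otimes(n-1)}\otimes\nabla_{t_n})\circ\cdots\circ(\mathrm{id}\otimes\nabla_{t_2})\circ\nabla_{t_1},\qquad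 D^n=n!\,\nabla^n ,$$ with values in $\mathbb M^{n,n+1}_2=L^2\big(\mathbb R_+^n;L^2(\mathcal{SC}^{\otimes(n+1)},\tau^{\otimes(n+1)})\big)$. For $k\ge1$, let $\mathbb D^{k,2,\sigma}\subset L^2(\mathcal{SC},\tau)$ be the completion of $\mathcal{SC}_{alg}$ for the norm $$\|F\|_{k,2,\sigma}=\Big(\|F\|_2^2+\sum_{j=1}^k\|D^jF\|^2_{\mathbb M_2^{j,j+1}}\Big)^{1/2},$$ and let $\mathbb D^{\infty,2,\sigma}=\bigcap_{k\ge1}\mathbb D^{k,2,\sigma}$. The operator $\nabla^n$ is closable from $L^2(\mathcal{SC},\tau)$ to $\mathbb M^{n,n+1}_2$; its closure, defined on $\mathbb D^{n,2,\sigma}$, is again denoted $\nabla^n$. **Proposition.** For every $F\in\mathbb D^{\infty,2,\sigma}$, $$\operatorname{var}(F):=\|F-\tau(F)\|_2^2=\sum_{n=1}^{\infty}\big\|\tau^{\otimes(n+1)}(\nabla^nF)\big\|^2_{L^2(\mathbb R_+^n)},$$ where $\tau$ is extended continuously to $L^2(\mathcal{SC},\tau)$ and $\tau^{\otimes(n+1)}(\nabla^nF)$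 denotes the function $(t_1,\dots,t_n)\mapsto\tau^{\otimes(n+1)}(\nabla^n_{t_1,\dots,t_n}F)$, defined Lebesgue-almost everywhere. -/

import Mathlib

open MeasureTheory Filter Topology
open scoped ENNReal ComplexConjugate ComplexOrder

namespace FreeWigner

noncomputable section

/-! ### Hilbert spaces spanned by a total family with a prescribed Gram kernel -/

/-- A positive semidefinite Hermitian kernel on `X`. -/
structure PosKernel (X : Type*) where
  ker : Matrix X X ℂ
  pos : ker.PosSemidef

/-- Formal finite linear combinations of the points of `X`. -/
def PosKernel.Pre {X : Type*} (_K : PosKernel X) : Type _ := X →₀ ℂ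

namespace PosKernel

variable {X : Type*} (K : PosKernel X)

instance : AddCommGroup K.Pre := inferInstanceAs (AddCommGroup (X →₀ ℂ))
instance : Module ℂ K.Pre := inferInstanceAs (Module ℂ (X →₀ ℂ))

/-- The semi-inner product `⟨∑ z_x x, ∑ w_y y⟩ = ∑ conj z_x * K x y * w_y`. -/
def form (f g : X →₀ ℂ) : ℂ := f.sum fun x z => g.sum fun y w => star z * K.ker x y * w

theorem form_conj_symm (f g : X →₀ ℂ) : conj (K.form g f) = K.form f g := by
  unfold form
  rw [Finsupp.sum_comm]
  simp only [map_finsuppSum]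
  refine Finsupp.sum_congr fun x _ => Finsupp.sum_congr fun y _ => ?_
  rw [← K.pos.1.apply x y]
  simp only [map_mul, starRingEnd_apply, star_star]
  ring

theorem form_add_left (f g h : X →₀ ℂ) : K.form (f + g) h = K.form f h + K.form g h := by
  unfold form
  rw [Finsupp.sum_add_index'] <;> simp [← Finsupp.sum_add, add_mul]

theorem form_smul_left (r : ℂ) (f g : X →₀ ℂ) : K.form (r • f) g = conj r * K.form f g := by
  unfold form
  rw [Finsupp.sum_smul_index] <;> simp [Finsupp.mul_sum, ← mul_assoc]

instance : PreInnerProductSpace.Core ℂ K.Pre where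
  inner f g := K.form f g
  conj_inner_symm f g := K.form_conj_symm f g
  re_inner_nonneg f := (RCLike.nonneg_iff.1 (K.pos.2 f)).1
  add_left f g h := K.form_add_left f g h
  smul_left f g r := K.form_smul_left r f g

instance : SeminormedAddCommGroup K.Pre :=
  InnerProductSpace.Core.toSeminormedAddCommGroup (𝕜 := ℂ)

instance : InnerProductSpace ℂ K.Pre := .ofCore _

/-- The identity map from finitely supported functions to `K.Pre`. -/
def toPre : (X →₀ ℂ) ≃ₗ[ℂ] K.Pre := LinearEquiv.refl ℂ (X →₀ ℂ)

theorem inner_toPre (f g : X →₀ ℂ) : inner ℂ (K.toPre f) (K.toPre g) = K.form f g := rfl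

/-- The Hilbert space generated by vectors `K.vec x` with `⟨K.vec x, K.vec y⟩ = K x y`:
the Hausdorff completion of the formal linear combinations. -/
abbrev Space : Type _ := UniformSpace.Completion K.Pre

/-- The vector attached to a point of `X`. -/
def vec (x : X) : K.Space := (K.toPre (Finsupp.single x 1) : K.Pre)

theorem inner_vec (x y : X) : inner ℂ (K.vec x) (K.vec y) = K.ker x y := by
  unfold vec
  rw [UniformSpace.Completion.inner_coe, inner_toPre]
  unfold form
  rw [Finsupp.sum_single_index (by simp), Finsupp.sum_single_index (by simp)]
  simp

end PosKernel

/-! ### Hilbert tensor powers and the full Fock space -/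

section Tensor

variable (E : Type*) [NormedAddCommGroup E] [InnerProductSpace ℂ E]

theorem gram_posSemidef {X : Type*} (u : X → E) :
    (Matrix.of fun x y => inner ℂ (u x) (u y)).PosSemidef := by
  refine ⟨?_, fun f => ?_⟩
  · ext x y
    simp
  · have h : (f.sum fun x z => f.sum fun y w =>
        star z * (Matrix.of fun x y => inner ℂ (u x) (u y)) x y * w) =
        inner ℂ (f.sum fun x z => z • u x) (f.sum fun x z => z • u x) := by
      rw [Finsupp.sum_inner]
      refine Finsupp.sum_congr fun x _ => ?_
      rw [Finsupp.inner_sum]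
      simp [mul_comm]
    rw [h]
    set v : E := f.sum fun x z => z • u x
    rw [inner_self_eq_norm_sq_to_K]
    simp

theorem tensorKernel_pos (m : ℕ) :
    (Matrix.of fun x y : Fin m → E => ∏ i, inner ℂ (x i) (y i)).PosSemidef := by
  have key : ∀ s : Finset (Fin m),
      (Matrix.of fun x y : Fin m → E => ∏ i ∈ s, inner ℂ (x i) (y i)).PosSemidef := by
    intro s
    induction s using Finset.induction_on with
    | empty =>
      have h := gram_posSemidef ℂ (fun _ : Fin m → E => (1 : ℂ))
      convert h using 1
      ext x y
      simp
    | insert a s ha ih =>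
      have h := (gram_posSemidef E (fun x : Fin m → E => x a)).hadamard ih
      have e : (Matrix.of fun x y : Fin m → E => ∏ i ∈ insert a s, inner ℂ (x i) (y i)) =
          (Matrix.of fun x y : Fin m → E => inner ℂ (x a) (y a)).hadamard
            (Matrix.of fun x y => ∏ i ∈ s, inner ℂ (x i) (y i)) := by
        ext x y
        simp [Finset.prod_insert ha]
      rw [e]
      exact h
  exact key Finset.univ

/-- The kernel `∏ i, ⟨x i, y i⟩` on `m`-tuples of vectors. -/
def tensorKernel (m : ℕ) : PosKernel (Fin m → E) where
  ker := Matrix.of fun x y => ∏ i, inner ℂ (x i) (y i)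
  pos := tensorKernel_pos E m

/-- The Hilbert space tensor power `E ⊗ ⋯ ⊗ E` (`m` factors): the completion of the span of the
elementary tensors for `⟨x₁ ⊗ ⋯ ⊗ x_m, y₁ ⊗ ⋯ ⊗ y_m⟩ = ∏ i, ⟨x_i, y_i⟩`
(the multilinearity relations have norm zero, so they hold in the completion). -/
abbrev TensorPow (m : ℕ) : Type _ := (tensorKernel E m).Space

variable {E}

/-- The elementary tensor `x₁ ⊗ ⋯ ⊗ x_m`. -/
def elemTensor {m : ℕ} (x : Fin m → E) : TensorPow E m := (tensorKernel E m).vec x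

/-- `⟨g₁ ⊗ ⋯ ⊗ g_n, h₁ ⊗ ⋯ ⊗ h_m⟩ = δ_{n,m} ⟨g₁, h₁⟩ ⋯ ⟨g_n, h_n⟩`; the empty word is the
vacuum vector. -/
def wordInner : List E → List E → ℂ
  | [], [] => 1
  | g :: v, h :: w => inner ℂ g h * wordInner v w
  | [], _ :: _ => 0
  | _ :: _, [] => 0

/-- Truncation of `wordInner` to words of length less than `N`. -/
def wordInnerTrunc : ℕ → List E → List E → ℂ
  | 0, _, _ => 0
  | N + 1, v, w => inner ℂ (if v = [] then (1 : ℂ) else 0) (if w = [] then (1 : ℂ) else 0) +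
      inner ℂ (v.headD 0) (w.headD 0) * wordInnerTrunc N v.tail w.tail

theorem wordInnerTrunc_eq (N : ℕ) (v w : List E) (h : v.length < N) :
    wordInnerTrunc N v w = wordInner v w := by
  induction N generalizing v w with
  | zero => omega
  | succ N ih =>
    cases v with
    | nil => cases w <;> simp [wordInnerTrunc, wordInner]
    | cons a v =>
      cases w with
      | nil => simp [wordInnerTrunc, wordInner]
      | cons b w =>
        have := ih v w (by simpa using h)
        simp [wordInnerTrunc, wordInner, this]

theorem wordInnerTrunc_pos (N : ℕ) :
    (Matrix.of fun v w : List E => wordInnerTrunc N v w).PosSemidef := by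
  induction N with
  | zero =>
    have h : (Matrix.of fun v w : List E => wordInnerTrunc 0 v w) = 0 := by
      ext v w
      simp [wordInnerTrunc]
    rw [h]
    exact Matrix.PosSemidef.zero
  | succ N ih =>
    have h1 := gram_posSemidef ℂ (fun v : List E => if v = [] then (1 : ℂ) else 0)
    have h2 := (gram_posSemidef E (fun v : List E => v.headD 0)).hadamard
      (ih.submatrix List.tail)
    exact h1.add h2

theorem wordInner_pos : (Matrix.of fun v w : List E => wordInner v w).PosSemidef := by
  refine ⟨?_, fun f => ?_⟩
  · ext v w
    have h := (wordInnerTrunc_pos (E := E) (max v.length w.length + 1)).1.apply v w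
    simp only [Matrix.of_apply] at h
    rw [wordInnerTrunc_eq _ _ _ (by omega), wordInnerTrunc_eq _ _ _ (by omega)] at h
    simpa using h
  · have h := (wordInnerTrunc_pos (E := E) (f.support.sup List.length + 1)).2 f
    convert h using 1
    refine Finsupp.sum_congr fun v hv => Finsupp.sum_congr fun w _ => ?_
    have := Finset.le_sup (f := List.length) hv
    simp only [Matrix.of_apply]
    rw [wordInnerTrunc_eq _ _ _ (by omega)]

variable (E) in
/-- The kernel `wordInner` on words. -/
def fockKernel : PosKernel (List E) where
  ker := Matrix.of fun v w => wordInner v w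
  pos := wordInner_pos

variable (E) in
/-- The full Fock space: the completion of `ℂΩ ⊕ ⨁_{n ≥ 1} E^{⊗ n}`. -/
abbrev FockSpace : Type _ := (fockKernel E).Space

/-- The vector `h₁ ⊗ ⋯ ⊗ h_n` of the Fock space. -/
def wordVec (w : List E) : FockSpace E := (fockKernel E).vec w

/-- The vacuum vector `Ω`. -/
def vacuum : FockSpace E := wordVec []

/-- Left tensoring with `h` on formal linear combinations of words. -/
def preCreation (h : E) : (fockKernel E).Pre →ₗ[ℂ] (fockKernel E).Pre :=
  (fockKernel E).toPre.toLinearMap ∘ₗ Finsupp.lmapDomain ℂ ℂ (fun w : List E => h :: w) ∘ₗ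
    (fockKernel E).toPre.symm.toLinearMap

theorem inner_preCreation (h : E) (f g : (fockKernel E).Pre) :
    inner ℂ (preCreation h f) (preCreation h g) = inner ℂ h h * inner ℂ f g := by
  obtain ⟨f, rfl⟩ := (fockKernel E).toPre.surjective f
  obtain ⟨g, rfl⟩ := (fockKernel E).toPre.surjective g
  simp only [preCreation, LinearMap.comp_apply, LinearEquiv.coe_coe, LinearEquiv.symm_apply_apply,
    PosKernel.inner_toPre, Finsupp.lmapDomain_apply]
  unfold PosKernel.form
  rw [Finsupp.sum_mapDomain_index (by simp) (by simp [add_mul, Finsupp.sum_add]), Finsupp.mul_sum]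
  refine Finsupp.sum_congr fun v _ => ?_
  rw [Finsupp.sum_mapDomain_index (by simp) (by simp [mul_add]), Finsupp.mul_sum]
  refine Finsupp.sum_congr fun w _ => ?_
  simp only [fockKernel, Matrix.of_apply, wordInner]
  ring

theorem norm_preCreation (h : E) (f : (fockKernel E).Pre) :
    ‖preCreation h f‖ ≤ ‖h‖ * ‖f‖ := by
  have key : ‖preCreation h f‖ ^ 2 = (‖h‖ * ‖f‖) ^ 2 := by
    have := inner_preCreation h f f
    rw [inner_self_eq_norm_sq_to_K, inner_self_eq_norm_sq_to_K, inner_self_eq_norm_sq_to_K] at this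
    rw [mul_pow]
    exact_mod_cast this
  exact le_of_eq ((sq_eq_sq₀ (norm_nonneg _) (by positivity)).1 key)

/-- The left creation operator `l(h)`. -/
def creation (h : E) : FockSpace E →L[ℂ] FockSpace E :=
  ((preCreation h).mkContinuous ‖h‖ (norm_preCreation h)).completion

theorem creation_wordVec (h : E) (w : List E) :
    creation h (wordVec w) = wordVec (h :: w) := by
  unfold creation wordVec PosKernel.vec
  rw [ContinuousLinearMap.completion_apply_coe]
  simp [preCreation]

end Tensor

/-! ### The Wigner space over `L²(ℝ₊)` -/

/-- Lebesgue measure on `ℝ₊ = [0, ∞)`. -/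
abbrev leb : Measure ℝ := volume.restrict (Set.Ici 0)

/-- Lebesgue measure on `ℝ₊ⁿ`. -/
abbrev lebPow (n : ℕ) : Measure (Fin n → ℝ) := Measure.pi fun _ => leb

/-- `L²_ℝ(ℝ₊)`. -/
abbrev HR : Type := Lp ℝ 2 leb

/-- `L²(ℝ₊)`, the complexification of `HR`. -/
abbrev HC : Type := Lp ℂ 2 leb

/-- The inclusion of real into complex square integrable functions. -/
def toHC (h : HR) : HC := Complex.ofRealCLM.compLp h

/-- The free Fock space of `L²(ℝ₊)`. By `X ↦ X Ω`, with `‖X Ω‖² = τ(X* X)`, it contains (as the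
closure of `SC Ω`) the noncommutative space `L²(SC, τ)`, `SC` being the von Neumann algebra
generated by the operators `semicirc h`. -/
abbrev Fock : Type := FockSpace HC

/-- The semicircular operator `S(h) = l(h) + l*(h)`, for real `h`. -/
def semicirc (h : HR) : Fock →L[ℂ] Fock :=
  creation (toHC h) + ContinuousLinearMap.adjoint (creation (toHC h))

/-- The product `S(h₁) ⋯ S(h_m)`. -/
def semicircWord (w : List HR) : Fock →L[ℂ] Fock := (w.map semicirc).prod

/-- Noncommutative polynomials in the letters `h ∈ L²_ℝ(ℝ₊)`: formal linear combinations of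
words. Evaluation at the semicircular operators maps them onto the unital `*`-algebra generated
by the `S(h)`. -/
abbrev Poly : Type := List HR →₀ ℂ

/-- Evaluation `h₁ ⋯ h_m ↦ S(h₁) ⋯ S(h_m)`. -/
def eval : Poly →ₗ[ℂ] (Fock →L[ℂ] Fock) := Finsupp.linearCombination ℂ semicircWord

/-- The element of `L²(SC, τ)` given by a polynomial in the semicircular operators. -/
def evalVec : Poly →ₗ[ℂ] Fock :=
  (ContinuousLinearMap.apply ℂ Fock (vacuum : Fock)).toLinearMap ∘ₗ eval

/-- The vacuum state on `L²(SC, τ)`: `τ(X) = ⟨X Ω, Ω⟩`. -/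
def tau : Fock →L[ℂ] ℂ := innerSL ℂ (vacuum : Fock)

/-- The state `τ^{⊗ m}` on `L²(SC^{⊗ m}, τ^{⊗ m})`, as the vector functional of `Ω^{⊗ m}`. -/
def tauPow (m : ℕ) : TensorPow Fock m →L[ℂ] ℂ :=
  innerSL ℂ (elemTensor fun _ : Fin m => (vacuum : Fock))

/-- `L²(ℝ₊ⁿ, L²(SC^{⊗ (n+1)}))`, with `L²(SC^{⊗ m})` realized in the `m`-th tensor power of the
Fock space by `X₁ ⊗ ⋯ ⊗ X_m ↦ X₁Ω ⊗ ⋯ ⊗ X_mΩ`. -/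
abbrev MultiProc (n : ℕ) : Type := Lp (TensorPow Fock (n + 1)) 2 (lebPow n)

/-! ### Iterated free Malliavin derivatives on polynomials -/

/-- The derivation `∇` on words: `(u, h, v)` stands for the term `h(t) · S(u) ⊗ S(v)` of `∇_t`.
The recursion is `∇ 1 = 0`, `∇ (S(h) X) = h · 1 ⊗ X + S(h) · ∇ X`. -/
def splits : List HR → List (List HR × HR × List HR)
  | [] => []
  | h :: w => ([], h, w) :: (splits w).map fun s => (h :: s.1, s.2.1, s.2.2)

/-- The Leibniz rule `∇(X Y) = ∇X · Y + X · ∇Y`, the left action being on the left leg and the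
right action on the right leg. -/
theorem splits_append (x y : List HR) :
    splits (x ++ y) = (splits x).map (fun s => (s.1, s.2.1, s.2.2 ++ y)) ++
      (splits y).map (fun s => (x ++ s.1, s.2.1, s.2.2)) := by
  induction x with
  | nil => simp [splits]
  | cons h x ih => simp [splits, ih, Function.comp_def]

/-- `∇ⁿ = (id^{⊗ (n-1)} ⊗ ∇_{t_n}) ∘ ⋯ ∘ (id ⊗ ∇_{t_2}) ∘ ∇_{t_1}` on words: the pair `(u, h)`
stands for the term `h₁(t₁) ⋯ h_n(t_n) · S(u₀) ⊗ ⋯ ⊗ S(u_n)`. The derivatives after the first one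
act on the right leg of `∇_{t_1}`. -/
def multiSplits : (n : ℕ) → List HR → List ((Fin (n + 1) → List HR) × (Fin n → HR))
  | 0, w => [(fun _ => w, Fin.elim0)]
  | n + 1, w => (splits w).flatMap fun s => (multiSplits n s.2.2).map fun c =>
      (Fin.cons s.1 c.1, Fin.cons s.2.1 c.2)

theorem memLp_prod {n : ℕ} (h : Fin n → HR) :
    MemLp (fun t : Fin n → ℝ => ∏ i, ((h i (t i) : ℝ) : ℂ)) 2 (lebPow n) := by
  have hm : AEStronglyMeasurable (fun t : Fin n → ℝ => ∏ i, ((h i (t i) : ℝ) : ℂ)) (lebPow n) := by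
    refine Finset.aestronglyMeasurable_fun_prod _ fun i _ => ?_
    exact Complex.continuous_ofReal.comp_aestronglyMeasurable
      ((Lp.aestronglyMeasurable (h i)).comp_quasiMeasurePreserving
        (Measure.quasiMeasurePreserving_eval _ i))
  rw [memLp_two_iff_integrable_sq_norm hm]
  have hi : Integrable (fun t : Fin n → ℝ => ∏ i, (fun i s => ‖h i s‖ ^ 2) i (t i)) (lebPow n) :=
    Integrable.fintype_prod fun i =>
      (memLp_two_iff_integrable_sq_norm (Lp.aestronglyMeasurable (h i))).1 (Lp.memLp (h i))
  convert hi using 2 with t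
  simp [Finset.prod_pow, ← Finset.abs_prod]

/-- The function `(t₁, …, t_n) ↦ h₁(t₁) ⋯ h_n(t_n)` in `L²(ℝ₊ⁿ)`. -/
def prodFun {n : ℕ} (h : Fin n → HR) : Lp ℂ 2 (lebPow n) := (memLp_prod h).toLp

/-- The multiprocess `t ↦ h₁(t₁) ⋯ h_n(t_n) · S(u₀) ⊗ ⋯ ⊗ S(u_n)`. -/
def elemProc {n : ℕ} (u : Fin (n + 1) → List HR) (h : Fin n → HR) : MultiProc n :=
  (ContinuousLinearMap.toSpanSingleton ℂ
    (elemTensor fun j => semicircWord (u j) (vacuum : Fock))).compLp (prodFun h)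

/-- `∇ⁿ` on a word. -/
def gradWord (n : ℕ) (w : List HR) : MultiProc n :=
  ((multiSplits n w).map fun c => elemProc c.1 c.2).sum

/-- The iterated free Malliavin derivative `∇ⁿ` on polynomials in the semicircular operators. -/
def grad (n : ℕ) : Poly →ₗ[ℂ] MultiProc n := Finsupp.linearCombination ℂ (gradWord n)

/-- The symmetrized derivative `Dⁿ = n! ∇ⁿ`. -/
def symGrad (n : ℕ) (P : Poly) : MultiProc n := (n.factorial : ℂ) • grad n P

/-! ### Sobolev–Wigner spaces and closures -/

/-- The norm `‖·‖_{k,2,σ}` of the `L²`-Sobolev–Wigner space of order `k`. -/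
def sobolevNorm (k : ℕ) (P : Poly) : ℝ :=
  Real.sqrt (‖evalVec P‖ ^ 2 + ∑ j ∈ Finset.Icc 1 k, ‖symGrad j P‖ ^ 2)

/-- `𝔻^{k,2,σ}`, the completion of the polynomials for `‖·‖_{k,2,σ}`, realized in `L²(SC, τ)`:
the `L²`-limits of `‖·‖_{k,2,σ}`-Cauchy sequences. -/
def sobolev (k : ℕ) : Set Fock :=
  {F | ∃ P : ℕ → Poly, Tendsto (fun i => evalVec (P i)) atTop (𝓝 F) ∧
    ∀ ε > 0, ∃ N, ∀ a ≥ N, ∀ b ≥ N, sobolevNorm k (P a - P b) < ε}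

/-- `𝔻^{∞,2,σ} = ⋂_{k ≥ 1} 𝔻^{k,2,σ}`. -/
def sobolevInf : Set Fock := {F | ∀ k ≥ 1, F ∈ sobolev k}

/-- The graph of the closure of `∇ⁿ`, as an unbounded operator from `L²(SC, τ)` to
`L²(ℝ₊ⁿ, L²(SC^{⊗ (n+1)}))` with the polynomials as initial domain. -/
def closedGraph (n : ℕ) : Submodule ℂ (Fock × MultiProc n) :=
  (LinearMap.range (evalVec.prod (grad n))).topologicalClosure

theorem exists_mem_closedGraph {n : ℕ} (hn : 1 ≤ n) {F : Fock} (hF : F ∈ sobolev n) :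
    ∃ U, (F, U) ∈ closedGraph n := by
  obtain ⟨P, hP, hc⟩ := hF
  have hcau : CauchySeq fun i => grad n (P i) := by
    rw [Metric.cauchySeq_iff]
    intro ε hε
    obtain ⟨N, hN⟩ := hc ε hε
    refine ⟨N, fun a ha b hb => ?_⟩
    refine lt_of_le_of_lt ?_ (hN a ha b hb)
    rw [dist_eq_norm, ← map_sub]
    refine Real.le_sqrt_of_sq_le ?_
    have h1 : ‖grad n (P a - P b)‖ ≤ ‖symGrad n (P a - P b)‖ := by
      unfold symGrad
      rw [norm_smul]
      have : (1 : ℝ) ≤ ‖(n.factorial : ℂ)‖ := by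
        rw [Complex.norm_natCast]
        exact_mod_cast Nat.succ_le_of_lt n.factorial_pos
      exact le_mul_of_one_le_left (norm_nonneg _) this
    have h2 : ‖symGrad n (P a - P b)‖ ^ 2 ≤
        ∑ j ∈ Finset.Icc 1 n, ‖symGrad j (P a - P b)‖ ^ 2 :=
      Finset.single_le_sum (f := fun j => ‖symGrad j (P a - P b)‖ ^ 2)
        (fun j _ => by positivity) (Finset.mem_Icc.2 ⟨hn, le_rfl⟩)
    have h3 : ‖grad n (P a - P b)‖ ^ 2 ≤ ‖symGrad n (P a - P b)‖ ^ 2 := by gcongr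
    have h4 : 0 ≤ ‖evalVec (P a - P b)‖ ^ 2 := by positivity
    linarith
  obtain ⟨U, hU⟩ := cauchySeq_tendsto_of_complete hcau
  refine ⟨U, ?_⟩
  exact mem_closure_of_tendsto (hP.prodMk_nhds hU)
    (Eventually.of_forall fun i => ⟨P i, rfl⟩)

open Classical in
/-- The value at `F` of the closure of `∇ⁿ`, i.e. the `U` such that `(F, U)` lies in the closed
graph (`∇ⁿ` being closable, there is only one); it exists for `F ∈ 𝔻^{n,2,σ}`, `n ≥ 1`, by
`exists_mem_closedGraph`, and the value is `0` for `F` outside the domain. -/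
def nabla (n : ℕ) (F : Fock) : MultiProc n :=
  if h : ∃ U, (F, U) ∈ closedGraph n then h.choose else 0

/-- `τ^{⊗ (n+1)}(U)`, the function `t ↦ τ^{⊗ (n+1)}(U_t)` in `L²(ℝ₊ⁿ)`. -/
def tauField (n : ℕ) (U : MultiProc n) : Lp ℂ 2 (lebPow n) := (tauPow (n + 1)).compLp U

/-- `var(F) = ‖F - τ(F)‖₂²`, where the scalar `τ(F)` stands for `τ(F) · 1`, i.e. `τ(F) Ω`. -/
def variance (F : Fock) : ℝ := ‖F - tau F • (vacuum : Fock)‖ ^ 2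

end

end FreeWigner

namespace FreeWigner

noncomputable section

/-! ### Maps out of the Hilbert space of a kernel -/

namespace PosKernel

variable {X : Type*} (K : PosKernel X)

/-! The theorem is Parseval's identity combined with a free Stroock formula. The Fock space embeds
isometrically in `⨁ₙ L²(ℝ₊ⁿ)`, its degree-zero part is the line of `Ω`, and so the variance of `F`
is the sum over n ≥ 1 of the squared norms of its chaos kernels (`hasSum_variance`). It remains to
see that the n-th kernel is `τ^{⊗(n+1)}(∇ⁿF)`.

For a word this is combinatorial. In `S(h₁)⋯S(h_m)Ω`, the degree-n part is obtained by choosing the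
n letters whose particles survive; each of the n+1 blocks between them must annihilate everything it
creates and contributes its vacuum expectation. The operator `∇ⁿ` sums over these same choices, with
the blocks as tensor legs, and `τ^{⊗(n+1)}` evaluates the blocks. The algebra behind this is
`semicircVec_eq`, which isolates the leftmost surviving letter and is then iterated.

Both sides of the formula are continuous in the pair (F, ∇ⁿF), so it extends from polynomials to the
closed graph (`tauField_of_mem_closedGraph`). -/

theorem ext_vec {G : Type*} [NormedAddCommGroup G] [NormedSpace ℂ G]
    {S T : K.Space →L[ℂ] G} (h : ∀ x, S (K.vec x) = T (K.vec x)) : S = T := by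
  ext z
  induction z using UniformSpace.Completion.induction_on with
  | hp => exact isClosed_eq S.continuous T.continuous
  | ih f =>
    obtain ⟨f, rfl⟩ := K.toPre.surjective f
    let ι : K.Pre →L[ℂ] K.Space := UniformSpace.Completion.toComplL
    have : (S.toLinearMap ∘ₗ ι.toLinearMap ∘ₗ K.toPre.toLinearMap) =
        (T.toLinearMap ∘ₗ ι.toLinearMap ∘ₗ K.toPre.toLinearMap) := by
      refine Finsupp.lhom_ext' fun x => LinearMap.ext_ring ?_
      exact h x
    exact LinearMap.congr_fun this f

variable {G : Type*} [NormedAddCommGroup G] [InnerProductSpace ℂ G]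

theorem norm_linearCombination (v : X → G) (hv : ∀ x y, inner ℂ (v x) (v y) = K.ker x y)
    (f : K.Pre) : ‖Finsupp.linearCombination ℂ v (K.toPre.symm f)‖ = ‖f‖ := by
  obtain ⟨f, rfl⟩ := K.toPre.surjective f
  rw [LinearEquiv.symm_apply_apply]
  have h : inner ℂ (Finsupp.linearCombination ℂ v f) (Finsupp.linearCombination ℂ v f) =
      inner ℂ (K.toPre f) (K.toPre f) := by
    rw [inner_toPre, Finsupp.linearCombination_apply, Finsupp.sum_inner]
    unfold form
    refine Finsupp.sum_congr fun x _ => ?_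
    rw [Finsupp.inner_sum]
    refine Finsupp.sum_congr fun y _ => ?_
    rw [inner_smul_left, inner_smul_right, hv, starRingEnd_apply]
    ring
  rw [inner_self_eq_norm_sq_to_K, inner_self_eq_norm_sq_to_K] at h
  exact (sq_eq_sq₀ (norm_nonneg _) (norm_nonneg _)).1 (by exact_mod_cast h)

/-- The isometry `K.vec x ↦ v x` attached to a family of vectors with Gram kernel `K`. -/
def lift [CompleteSpace G] (v : X → G) (hv : ∀ x y, inner ℂ (v x) (v y) = K.ker x y) :
    K.Space →ₗᵢ[ℂ] G where
  toLinearMap := ((Finsupp.linearCombination ℂ v ∘ₗ K.toPre.symm.toLinearMap).extendOfNorm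
    (UniformSpace.Completion.toComplL (𝕜 := ℂ) (E := K.Pre)).toLinearMap).toLinearMap
  norm_map' z := by
    induction z using UniformSpace.Completion.induction_on with
    | hp => exact isClosed_eq (ContinuousLinearMap.continuous _).norm continuous_norm
    | ih f =>
      rw [UniformSpace.Completion.norm_coe, ← K.norm_linearCombination v hv f]
      refine congrArg norm (LinearMap.extendOfNorm_eq UniformSpace.Completion.denseRange_coe
        ⟨1, fun g => ?_⟩ f)
      rw [one_mul]
      exact ((K.norm_linearCombination v hv g).trans (UniformSpace.Completion.norm_coe g).symm).le

theorem lift_vec [CompleteSpace G] (v : X → G) (hv : ∀ x y, inner ℂ (v x) (v y) = K.ker x y)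
    (x : X) : K.lift v hv (K.vec x) = v x := by
  refine (LinearMap.extendOfNorm_eq UniformSpace.Completion.denseRange_coe
        ⟨1, fun g => ?_⟩ _).trans ?_
  · rw [one_mul]
    exact ((K.norm_linearCombination v hv g).trans (UniformSpace.Completion.norm_coe g).symm).le
  · simp

end PosKernel

/-! ### The chaos decomposition of the Fock space of `L²(ℝ₊)` -/

theorem memLp_prod_complex {n : ℕ} (h : Fin n → HC) :
    MemLp (fun t : Fin n → ℝ => ∏ i, h i (t i)) 2 (lebPow n) := by
  have hm : AEStronglyMeasurable (fun t : Fin n → ℝ => ∏ i, h i (t i)) (lebPow n) :=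
    Finset.aestronglyMeasurable_fun_prod _ fun i _ =>
      (Lp.aestronglyMeasurable (h i)).comp_quasiMeasurePreserving
        (Measure.quasiMeasurePreserving_eval _ i)
  rw [memLp_two_iff_integrable_sq_norm hm]
  have hi : Integrable (fun t : Fin n → ℝ => ∏ i, (fun i s => ‖h i s‖ ^ 2) i (t i)) (lebPow n) :=
    Integrable.fintype_prod fun i =>
      (memLp_two_iff_integrable_sq_norm (Lp.aestronglyMeasurable (h i))).1 (Lp.memLp (h i))
  convert hi using 2 with t
  simp [Finset.prod_pow]

/-- The function `(t₁, …, t_n) ↦ h₁(t₁) ⋯ h_n(t_n)` in `L²(ℝ₊ⁿ)`, for complex `h_i`. -/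
def prodFunComplex {n : ℕ} (h : Fin n → HC) : Lp ℂ 2 (lebPow n) := (memLp_prod_complex h).toLp

/-- Fubini: the integral of a product of functions of separate variables factors. -/
theorem inner_prodFunComplex {n : ℕ} (g h : Fin n → HC) :
    inner ℂ (prodFunComplex g) (prodFunComplex h) = ∏ i, inner ℂ (g i) (h i) := by
  simp only [L2.inner_def]
  rw [← integral_fintype_prod_eq_prod (fun i s => inner ℂ (g i s) (h i s))]
  refine integral_congr_ae ?_
  filter_upwards [(memLp_prod_complex g).coeFn_toLp, (memLp_prod_complex h).coeFn_toLp]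
    with t hg hh
  simp only [prodFunComplex, hg, hh, RCLike.inner_apply, map_prod, Finset.prod_mul_distrib]

theorem prodFunComplex_toHC {n : ℕ} (h : Fin n → HR) :
    prodFunComplex (fun i => toHC (h i)) = prodFun h := by
  refine MemLp.toLp_congr _ _ ?_
  have : ∀ᵐ t ∂lebPow n, ∀ i, toHC (h i) (t i) = ((h i (t i) : ℝ) : ℂ) :=
    ae_all_iff.2 fun i => (Measure.quasiMeasurePreserving_eval (fun _ => leb) i).ae
      (Complex.ofRealCLM.coeFn_compLp (h i))
  filter_upwards [this] with t ht
  exact Finset.prod_congr rfl fun i _ => ht i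

/-- The Hilbert sum `⨁ₙ L²(ℝ₊ⁿ)`. -/
abbrev ChaosSum : Type := lp (fun n => Lp ℂ 2 (lebPow n)) 2

/-- The function `h₁(t₁) ⋯ h_n(t_n)` attached to a word, as an element of `⨁ₙ L²(ℝ₊ⁿ)`. -/
def chaosVec (w : List HC) : ChaosSum :=
  lp.single 2 (List.equivSigmaTuple w).1 (prodFunComplex (List.equivSigmaTuple w).2)

/-- Writing words as `List.ofFn h` makes their length a variable n, which avoids transport between
the spaces `L²(ℝ₊ⁿ)`. -/
theorem chaosVec_ofFn {n : ℕ} (h : Fin n → HC) :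
    chaosVec (List.ofFn h) = lp.single 2 n (prodFunComplex h) := by
  have : List.equivSigmaTuple (List.ofFn h) = ⟨n, h⟩ :=
    List.equivSigmaTuple.apply_symm_apply ⟨n, h⟩
  rw [chaosVec, this]

theorem wordInner_eq_zero {E : Type*} [NormedAddCommGroup E] [InnerProductSpace ℂ E]
    (v w : List E) (h : v.length ≠ w.length) : wordInner v w = 0 := by
  induction v generalizing w with
  | nil => cases w <;> simp_all [wordInner]
  | cons a v ih =>
    cases w with
    | nil => rfl
    | cons b w => rw [wordInner, ih w (by simpa using h), mul_zero]

theorem wordInner_ofFn {E : Type*} [NormedAddCommGroup E] [InnerProductSpace ℂ E]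
    {n : ℕ} (g h : Fin n → E) :
    wordInner (List.ofFn g) (List.ofFn h) = ∏ i, inner ℂ (g i) (h i) := by
  induction n with
  | zero => simp [wordInner]
  | succ n ih => rw [List.ofFn_succ, List.ofFn_succ, wordInner, ih, Fin.prod_univ_succ]

theorem exists_ofFn {α : Type*} (w : List α) : ∃ (n : ℕ) (h : Fin n → α), w = List.ofFn h :=
  ⟨_, _, (List.ofFn_get w).symm⟩

/-- Words of different lengths land in orthogonal summands, and words of equal length are handled by
Fubini. Equality of Gram kernels is all that `lift` needs. -/
theorem inner_chaosVec (v w : List HC) :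
    inner ℂ (chaosVec v) (chaosVec w) = (fockKernel HC).ker v w := by
  obtain ⟨m, g, rfl⟩ := exists_ofFn v
  obtain ⟨n, h, rfl⟩ := exists_ofFn w
  rw [chaosVec_ofFn, chaosVec_ofFn, lp.inner_single_left]
  by_cases hmn : m = n
  · subst hmn
    rw [lp.single_apply_self, inner_prodFunComplex]
    exact (wordInner_ofFn g h).symm
  · rw [lp.single_apply_ne _ _ _ hmn, inner_zero_right]
    exact (wordInner_eq_zero _ _ (by simpa using hmn)).symm

/-- The identification of the Fock space with `⨁ₙ L²(ℝ₊ⁿ)`. -/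
def chaos : Fock →ₗᵢ[ℂ] ChaosSum := (fockKernel HC).lift chaosVec inner_chaosVec

/-- The `n`-th chaos kernel of a vector of the Fock space. -/
def chaosKernel (n : ℕ) : Fock →L[ℂ] Lp ℂ 2 (lebPow n) :=
  lp.evalCLM ℂ (fun n => Lp ℂ 2 (lebPow n)) 2 n ∘L chaos.toContinuousLinearMap

theorem chaosKernel_apply (n : ℕ) (F : Fock) : chaosKernel n F = chaos F n := rfl

/-- Parseval; only the isometry of `chaos` is needed, not its surjectivity. -/
theorem hasSum_norm_chaosKernel (F : Fock) :
    HasSum (fun n => ‖chaosKernel n F‖ ^ 2) (‖F‖ ^ 2) := by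
  have h := lp.hasSum_norm (by simp) (chaos F)
  rw [chaos.norm_map] at h
  simpa [chaosKernel_apply] using h

theorem chaos_wordVec (w : List HC) : chaos (wordVec w) = chaosVec w :=
  PosKernel.lift_vec _ _ _ w

theorem chaosKernel_wordVec_ofFn {n : ℕ} (h : Fin n → HC) :
    chaosKernel n (wordVec (List.ofFn h)) = prodFunComplex h := by
  rw [chaosKernel_apply, chaos_wordVec, chaosVec_ofFn, lp.single_apply_self]

theorem chaosKernel_wordVec_ofFn_of_ne {m n : ℕ} (h : Fin n → HC) (hmn : m ≠ n) :
    chaosKernel m (wordVec (List.ofFn h)) = 0 := by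
  rw [chaosKernel_apply, chaos_wordVec, chaosVec_ofFn, lp.single_apply_ne _ _ _ hmn]

theorem vacuum_eq_wordVec_ofFn : (vacuum : Fock) = wordVec (List.ofFn Fin.elim0) := by
  simp [vacuum]

theorem tau_wordVec (w : List HC) : tau (wordVec w) = wordInner [] w :=
  (fockKernel HC).inner_vec [] w

theorem tau_vacuum : tau vacuum = 1 := tau_wordVec []

theorem chaosKernel_zero (F : Fock) :
    chaosKernel 0 F = tau F • chaosKernel 0 vacuum := by
  suffices chaosKernel 0 = tau.smulRight (chaosKernel 0 vacuum) from
    congrArg (fun T : Fock →L[ℂ] Lp ℂ 2 (lebPow 0) => T F) this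
  refine PosKernel.ext_vec _ fun w => ?_
  change chaosKernel 0 (wordVec w) = tau (wordVec w) • chaosKernel 0 vacuum
  rw [tau_wordVec]
  obtain ⟨n, h, rfl⟩ := exists_ofFn w
  cases n with
  | zero => simp [vacuum, wordInner]
  | succ n => rw [chaosKernel_wordVec_ofFn_of_ne h (by simp), wordInner_eq_zero _ _ (by simp),
      zero_smul]

/-- Subtracting `τ(F)Ω` kills the degree-zero kernel and leaves all others unchanged. -/
theorem hasSum_variance (F : Fock) :
    HasSum (fun n => ‖chaosKernel (n + 1) F‖ ^ 2) (variance F) := by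
  have h := hasSum_norm_chaosKernel (F - tau F • (vacuum : Fock))
  rw [← hasSum_nat_add_iff' 1] at h
  have h0 : chaosKernel 0 (F - tau F • (vacuum : Fock)) = 0 := by
    rw [map_sub, map_smul, chaosKernel_zero F, sub_self]
  have h1 (n : ℕ) : chaosKernel (n + 1) (F - tau F • (vacuum : Fock)) = chaosKernel (n + 1) F := by
    rw [map_sub, map_smul, vacuum_eq_wordVec_ofFn, chaosKernel_wordVec_ofFn_of_ne _ (by simp),
      smul_zero, sub_zero]
  unfold variance
  simpa only [h1, Finset.sum_range_one, h0, norm_zero, zero_pow two_ne_zero, sub_zero] using h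

/-! ### Expansion of semicircular words -/

theorem ext_inner_wordVec {F G : Fock}
    (h : ∀ w : List HC, inner ℂ F (wordVec w) = inner ℂ G (wordVec w)) : F = G :=
  have hFG : innerSL ℂ F = innerSL ℂ G := PosKernel.ext_vec _ h
  ext_inner_right ℂ fun v => congrArg (fun T : Fock →L[ℂ] ℂ => T v) hFG

theorem inner_wordVec (v w : List HC) :
    inner ℂ (wordVec v : Fock) (wordVec w) = wordInner v w :=
  (fockKernel HC).inner_vec v w

/-- The free commutation relation `l(h)* l(g) = ⟨h, g⟩`, tested on words. -/
theorem adjoint_creation_creation (h g : HC) (F : Fock) :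
    ContinuousLinearMap.adjoint (creation h) (creation g F) = inner ℂ h g • F := by
  suffices ContinuousLinearMap.adjoint (creation h) ∘L creation g =
      inner ℂ h g • ContinuousLinearMap.id ℂ Fock from
    congrArg (fun T : Fock →L[ℂ] Fock => T F) this
  refine PosKernel.ext_vec _ fun v => ext_inner_wordVec fun w => ?_
  change inner ℂ (ContinuousLinearMap.adjoint (creation h) (creation g (wordVec v))) (wordVec w) =
    inner ℂ (inner ℂ h g • wordVec v) (wordVec w)
  rw [ContinuousLinearMap.adjoint_inner_left, creation_wordVec, creation_wordVec, inner_smul_left,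
    inner_wordVec, inner_wordVec, wordInner, inner_conj_symm]

theorem adjoint_creation_vacuum (h : HC) :
    ContinuousLinearMap.adjoint (creation h) (vacuum : Fock) = 0 := by
  refine ext_inner_wordVec fun w => ?_
  rw [ContinuousLinearMap.adjoint_inner_left, creation_wordVec, inner_zero_left]
  exact inner_wordVec [] (h :: w)

theorem tau_creation (h : HC) (F : Fock) : tau (creation h F) = 0 := by
  change inner ℂ (vacuum : Fock) (creation h F) = 0
  rw [← ContinuousLinearMap.adjoint_inner_left, adjoint_creation_vacuum, inner_zero_left]

/-- The vector `S(h₁) ⋯ S(h_m) Ω`. -/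
def semicircVec (w : List HR) : Fock := semicircWord w (vacuum : Fock)

theorem semicircVec_cons (h : HR) (w : List HR) :
    semicircVec (h :: w) = creation (toHC h) (semicircVec w) +
      ContinuousLinearMap.adjoint (creation (toHC h)) (semicircVec w) := by
  simp [semicircVec, semicircWord, semicirc]

theorem length_lt_of_mem_splits {w : List HR} {s : List HR × HR × List HR} (hs : s ∈ splits w) :
    s.1.length < w.length ∧ s.2.2.length < w.length := by
  induction w generalizing s with
  | nil => simp [splits] at hs
  | cons h w ih =>
    simp only [splits, List.mem_cons, List.mem_map] at hs
    rcases hs with rfl | ⟨a, ha, rfl⟩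
    · simp
    · exact ⟨Nat.succ_lt_succ (ih ha).1, (ih ha).2.trans (by simp)⟩

/-- Coassociativity of the deconcatenation `splits`. -/
theorem sum_splits_splits {M : Type*} [AddCommMonoid M] (w : List HR)
    (f : List HR → HR → List HR → HR → List HR → M) :
    ((splits w).map fun s => ((splits s.1).map fun r =>
        f r.1 r.2.1 r.2.2 s.2.1 s.2.2).sum).sum =
      ((splits w).map fun s => ((splits s.2.2).map fun r =>
        f s.1 s.2.1 r.1 r.2.1 r.2.2).sum).sum := by
  induction w generalizing f with
  | nil => simp [splits]
  | cons h w ih =>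
    have := ih fun a => f (h :: a)
    simp only [splits, List.map_cons, List.sum_cons, List.map_map, Function.comp_def,
      List.map_nil, List.sum_nil, zero_add, List.sum_map_add, this]

/-- The expansion of `w` enters as a hypothesis because this lemma serves inside the induction that
proves it. `l(h)*` kills the vacuum term and cancels the leading creation operator in each other
term. -/
theorem adjoint_creation_semicircVec {w : List HR} (h : HC)
    (hw : semicircVec w = tau (semicircVec w) • vacuum + ((splits w).map fun s =>
      tau (semicircVec s.1) • creation (toHC s.2.1) (semicircVec s.2.2)).sum) :
    ContinuousLinearMap.adjoint (creation h) (semicircVec w) = ((splits w).map fun s =>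
      (tau (semicircVec s.1) * inner ℂ h (toHC s.2.1)) • semicircVec s.2.2).sum := by
  rw [hw, map_add, map_smul, adjoint_creation_vacuum, smul_zero, zero_add, map_list_sum,
    List.map_map]
  refine congrArg List.sum (List.map_congr_left fun s _ => ?_)
  rw [Function.comp_apply, map_smul, adjoint_creation_creation, smul_smul]

/-- The Schwinger–Dyson recursion: the first letter `h` is paired with some letter of `w`, and the
two blocks thus separated factorize. -/
theorem tau_semicircVec_cons {w : List HR} (h : HR)
    (hw : semicircVec w = tau (semicircVec w) • vacuum + ((splits w).map fun s =>
      tau (semicircVec s.1) • creation (toHC s.2.1) (semicircVec s.2.2)).sum) :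
    tau (semicircVec (h :: w)) = ((splits w).map fun s => tau (semicircVec s.1) *
      inner ℂ (toHC h) (toHC s.2.1) * tau (semicircVec s.2.2)).sum := by
  rw [semicircVec_cons, map_add, tau_creation, zero_add, adjoint_creation_semicircVec _ hw,
    map_list_sum, List.map_map]
  refine congrArg List.sum (List.map_congr_left fun s _ => ?_)
  rw [Function.comp_apply, map_smul, smul_eq_mul]

theorem list_sum_map_smul {α R M : Type*} [Semiring R] [AddCommMonoid M] [Module R M]
    (l : List α) (f : α → R) (x : M) : (l.map f).sum • x = (l.map fun a => f a • x).sum := by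
  induction l with
  | nil => simp
  | cons a l ih => simp [add_smul, ih]

/-- Expansion of `S(w) Ω` according to the first letter that creates a particle which is never
annihilated. -/
theorem semicircVec_eq (w : List HR) :
    semicircVec w = tau (semicircVec w) • vacuum + ((splits w).map fun s =>
      tau (semicircVec s.1) • creation (toHC s.2.1) (semicircVec s.2.2)).sum := by
  induction hn : w.length using Nat.strong_induction_on generalizing w with
  | _ n ih =>
    subst hn
    cases w with
    | nil => simp [splits, semicircVec, semicircWord, tau_vacuum]
    | cons h w =>
      -- Strong induction is needed: the expansion is used for `w` and also for the prefixes and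
      -- suffixes of its splittings.
      have hw := ih w.length (by simp) w rfl
      have hl {s : List HR × HR × List HR} (hs : s ∈ splits w) :=
        length_lt_of_mem_splits hs
      have h1 : tau (semicircVec []) = 1 := by simp [semicircVec, semicircWord, tau_vacuum]
      -- The coefficients `τ(S(h)S(u))` on the right are expanded by pairing `h` inside the prefix
      -- `u`; coassociativity then turns the double sum into one over splittings of the suffix.
      have hL : ((splits w).map fun s => tau (semicircVec (h :: s.1)) •
          creation (toHC s.2.1) (semicircVec s.2.2)).sum =
          ((splits w).map fun s => ((splits s.1).map fun r => (tau (semicircVec r.1) *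
            inner ℂ (toHC h) (toHC r.2.1) * tau (semicircVec r.2.2)) •
              creation (toHC s.2.1) (semicircVec s.2.2)).sum).sum := by
        refine congrArg List.sum (List.map_congr_left fun s hs => ?_)
        rw [tau_semicircVec_cons h (ih _ ((hl hs).1.trans (by simp)) _ rfl), list_sum_map_smul]
      rw [tau_semicircVec_cons h hw, semicircVec_cons, adjoint_creation_semicircVec _ hw, splits,
        List.map_cons, List.sum_cons, List.map_map, h1, one_smul, list_sum_map_smul,
        add_left_comm]
      refine congrArg _ ?_
      simp only [Function.comp_def]
      rw [hL, sum_splits_splits w fun a k b k' c => (tau (semicircVec a) *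
        inner ℂ (toHC h) (toHC k) * tau (semicircVec b)) • creation (toHC k') (semicircVec c),
        ← List.sum_map_add]
      refine congrArg List.sum (List.map_congr_left fun s hs => ?_)
      -- On the left, expand the suffix vector: its vacuum part yields `τ(S(h)S(w))Ω`, the rest
      -- matches the double sum.
      conv_lhs => rw [ih _ ((hl hs).2.trans (by simp)) s.2.2 rfl]
      rw [smul_add, smul_smul, List.smul_sum, List.map_map]
      simp only [Function.comp_def, smul_smul]

/-- The component of `S(w) Ω` of degree `n`, expressed by `multiSplits`. -/
def chaosTerm (n : ℕ) (w : List HR) : Fock :=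
  ((multiSplits n w).map fun c => (∏ i, tau (semicircVec (c.1 i))) •
    (wordVec (List.ofFn fun i => toHC (c.2 i)) : Fock)).sum

theorem chaosTerm_zero (w : List HR) :
    chaosTerm 0 w = tau (semicircVec w) • vacuum := by
  simp [chaosTerm, multiSplits, vacuum]

theorem chaosTerm_succ (n : ℕ) (w : List HR) :
    chaosTerm (n + 1) w = ((splits w).map fun s =>
      tau (semicircVec s.1) • creation (toHC s.2.1) (chaosTerm n s.2.2)).sum := by
  simp only [chaosTerm, multiSplits, List.flatMap, List.map_flatten, List.map_map, List.sum_flatten]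
  refine congrArg List.sum (List.map_congr_left fun s _ => ?_)
  simp only [Function.comp_def, List.map_map]
  rw [map_list_sum, List.smul_sum, List.map_map, List.map_map]
  refine congrArg List.sum (List.map_congr_left fun c _ => ?_)
  simp only [Function.comp_apply, map_smul, creation_wordVec, smul_smul, Fin.prod_univ_succ,
    Fin.cons_zero, Fin.cons_succ, List.ofFn_succ]

/-- Iterates `semicircVec_eq` on the suffix, which is strictly shorter than the word, so N steps
exhaust it. -/
theorem semicircVec_eq_sum {N : ℕ} {w : List HR} (h : w.length < N) :
    semicircVec w = ∑ n ∈ Finset.range N, chaosTerm n w := by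
  induction N generalizing w with
  | zero => omega
  | succ N ih =>
    rw [Finset.sum_range_succ', chaosTerm_zero]
    nth_rewrite 1 [semicircVec_eq w]
    rw [add_comm]
    simp only [chaosTerm_succ]
    have hswap (l : List (List HR × HR × List HR)) (f : ℕ → List HR × HR × List HR → Fock) :
        ∑ n ∈ Finset.range N, (l.map (f n)).sum =
          (l.map fun s => ∑ n ∈ Finset.range N, f n s).sum := by
      induction l with
      | nil => simp
      | cons a l ih => simp [Finset.sum_add_distrib, ih]
    rw [hswap]
    congr 2
    refine List.map_congr_left fun s hs => ?_
    have := (length_lt_of_mem_splits hs).2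
    rw [ih (w := s.2.2) (by omega), map_sum, Finset.smul_sum]

theorem chaosKernel_chaosTerm_of_ne {m n : ℕ} (hmn : m ≠ n) (w : List HR) :
    chaosKernel m (chaosTerm n w) = 0 := by
  rw [chaosTerm, map_list_sum, List.map_map]
  refine List.sum_eq_zero fun x hx => ?_
  obtain ⟨c, -, rfl⟩ := List.mem_map.1 hx
  rw [Function.comp_apply, map_smul, chaosKernel_wordVec_ofFn_of_ne _ hmn, smul_zero]

theorem chaosKernel_semicircVec (n : ℕ) (w : List HR) :
    chaosKernel n (semicircVec w) =
      ((multiSplits n w).map fun c => (∏ i, tau (semicircVec (c.1 i))) • prodFun c.2).sum := by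
  -- This N exceeds both the length of `w` and n, so the degree-n term occurs in the range.
  rw [semicircVec_eq_sum (N := w.length + n + 1) (by omega), map_sum,
    Finset.sum_eq_single_of_mem n (by simp)
      fun m _ hm => chaosKernel_chaosTerm_of_ne hm.symm w,
    chaosTerm, map_list_sum, List.map_map]
  refine congrArg List.sum (List.map_congr_left fun c _ => ?_)
  rw [Function.comp_apply, map_smul, chaosKernel_wordVec_ofFn, prodFunComplex_toHC]

/-! ### Vacuum expectation of the iterated derivatives -/

/-- `tauField` as a continuous linear map. -/
def tauFieldL (n : ℕ) : MultiProc n →L[ℂ] Lp ℂ 2 (lebPow n) :=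
  (tauPow (n + 1)).compLpL 2 (lebPow n)

theorem tauPow_elemTensor {m : ℕ} (x : Fin m → Fock) :
    tauPow m (elemTensor x) = ∏ i, tau (x i) :=
  (tensorKernel Fock m).inner_vec _ x

theorem tauFieldL_elemProc {n : ℕ} (u : Fin (n + 1) → List HR) (h : Fin n → HR) :
    tauFieldL n (elemProc u h) = (∏ i, tau (semicircVec (u i))) • prodFun h := by
  refine Lp.ext ?_
  filter_upwards [(tauPow (n + 1)).coeFn_compLpL (p := 2) (elemProc u h),
    (ContinuousLinearMap.toSpanSingleton ℂ
      (elemTensor fun j => semicircWord (u j) (vacuum : Fock))).coeFn_compLp (prodFun h),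
    Lp.coeFn_smul (∏ i, tau (semicircVec (u i))) (prodFun h)] with t h1 h2 h3
  rw [h3, tauFieldL, h1, elemProc, h2, ContinuousLinearMap.toSpanSingleton_apply, map_smul,
    tauPow_elemTensor, Pi.smul_apply, smul_eq_mul, smul_eq_mul, mul_comm]
  rfl

/-- Stroock's formula on polynomials: by linearity it suffices to compare the two sums over
`multiSplits` for a word. -/
theorem tauFieldL_grad (n : ℕ) (P : Poly) :
    tauFieldL n (grad n P) = chaosKernel n (evalVec P) := by
  suffices (tauFieldL n).toLinearMap ∘ₗ grad n = (chaosKernel n).toLinearMap ∘ₗ evalVec from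
    LinearMap.congr_fun this P
  refine Finsupp.lhom_ext' fun w => LinearMap.ext_ring ?_
  have hw : evalVec (Finsupp.single w 1) = semicircVec w := by
    simp [evalVec, eval, semicircVec]
  simp only [LinearMap.comp_apply, Finsupp.lsingle_apply, ContinuousLinearMap.coe_coe, hw, grad,
    Finsupp.linearCombination_single, one_smul, gradWord]
  rw [chaosKernel_semicircVec, map_list_sum, List.map_map]
  exact congrArg List.sum (List.map_congr_left fun c _ => tauFieldL_elemProc c.1 c.2)

/-- The identity defines a closed set containing the graph on polynomials. It holds for every `U`
over `F`, so the choice made in `nabla` is harmless and closability need not be invoked. -/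
theorem tauField_of_mem_closedGraph {n : ℕ} {F : Fock} {U : MultiProc n}
    (h : (F, U) ∈ closedGraph n) : tauField n U = chaosKernel n F := by
  have hc : IsClosed {p : Fock × MultiProc n | tauFieldL n p.2 = chaosKernel n p.1} :=
    isClosed_eq ((tauFieldL n).continuous.comp continuous_snd)
      ((chaosKernel n).continuous.comp continuous_fst)
  refine closure_minimal ?_ hc h
  rintro _ ⟨P, rfl⟩
  exact tauFieldL_grad n P

theorem tauField_nabla {n : ℕ} (hn : 1 ≤ n) {F : Fock} (hF : F ∈ sobolev n) :
    tauField n (nabla n F) = chaosKernel n F := by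
  have h := exists_mem_closedGraph hn hF
  rw [nabla, dif_pos h]
  exact tauField_of_mem_closedGraph h.choose_spec

end

end FreeWigner

theorem mainTheorem9 (F : FreeWigner.Fock) (hF : F ∈ FreeWigner.sobolevInf) :
    HasSum (fun n : ℕ => ‖FreeWigner.tauField (n + 1) (FreeWigner.nabla (n + 1) F)‖ ^ 2)
      (FreeWigner.variance F) := by
  have h (n : ℕ) := FreeWigner.tauField_nabla (n.succ_pos) (hF (n + 1) n.succ_pos)
  simpa only [h] using FreeWigner.hasSum_variance F
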